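/- **Conventions.** $\omega_1$ is the set of countable ordinals and $[X]^{<\omega}$ the set of finite subsets of $X$. For finite sets of ordinals, $A<B$ means that $a<b$ for all $a\in A$, $b\in B$, and $C\sqsubseteq D$ means that $C$ is an initial segment of $D$. For $\mathcal F\subseteq[\omega_1]^{<\omega}$, $\mathcal F_k$ denotes the set of elements of rank $k$ in the well-founded order $(\mathcal F,\subsetneq)$. **Types.** A *type* is a sequence $\tau=\{(m_k,n_{k+1},r_{k+1})\}_{k\in\omega}\subseteq\omega^3$ such that $m_0=1$; $n_k\ge 2$ for all $k\ge 1$; for every $r\in\omega$ there are infinitely many $k\geq 1$ with $r_k=r$; $m_k>r_{k+1}$ for all $k\in\omega$; and $m_{k+1}=r_{k+1}+(m_k-r_{k+1})\,n_{k+1}$ for all $k\in\omega$. **Construction schemes.** $\mathcal F\subseteq[\omega_1]^{<\omega}$ is a *construction scheme* over $\omega_1$ of type $\tau$ if: (1) every finite $A\subseteq\omega_1$ is contained in some $F\in\mathcal F$; (2) $|F|=m_k$ for all $k\in\omega$ and $F\in\mathcal F_k$; (3) $E\cap F\sqsubseteq E$ and $E\cap F\sqsubseteq F$ for all $k\in\omega$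 and $E,F\in\mathcal F_k$; (4) for all $k\in\omega$ and $F\in\mathcal F_{k+1}$ there is a unique family $\{F_i\}_{i<n_{k+1}}\subseteq\mathcal F_k$ (unique as an unordered family) with $F=\bigcup_{i<n_{k+1}}F_i$; moreover it can be enumerated so that, for some set $R(F)$ with $|R(F)|=r_{k+1}$, one has $F_i\cap F_j=R(F)$ for $i\ne j$ and $R(F)<F_0\setminus R(F)<\dots<F_{n_{k+1}-1}\setminus R(F)$. Such an $F\in\mathcal F_{k+1}$ *captures* a finite $\mathcal C\subseteq[\omega_1]^{<\omega}$ if $|\mathcal C|\le n_{k+1}$ and $\mathcal C$ has an enumeration $\{c_i\}_{i<|\mathcal C|}$ such that for each $i<|\mathcal C|$: $c_i\subseteq F_i$, $c_i\setminus R(F)\ne\emptyset$, and the increasing bijection from $F_0$ to $F_i$ maps $c_0$ onto $c_i$. The scheme $\mathcal F$ is *$n$-capturing* if for every uncountable $S\subseteq[\omega_1]^{<\omega}$ and every $k\in\omega$ there are $\mathcal C\subseteq S$ with $|\mathcal C|=n$, $l>k$ and $F\in\mathcal F_l$ such that $F$ captures $\mathcal C$. The axiom $CA_2$ says: for every type there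 is a $2$-capturing construction scheme over $\omega_1$ of that type. For a construction scheme $\mathcal F$ over $\omega_1$ let $\rho(\alpha,\beta)=\min\{k\in\omega : \exists F\in\mathcal F_k\ \{\alpha,\beta\}\subseteq F\}$, $(\alpha)_k=\{\xi\le\alpha : \rho(\xi,\alpha)\le k\}$, $f_\alpha(l)=|(\alpha)_l|$ for $\alpha\in\omega_1$, $l\in\omega$, and $\mathcal B_{\mathcal F}=\{f_\alpha : \alpha\in\omega_1\}\subseteq\omega^\omega$, with the pointwise order $\le$. **Tukey order.** For directed partial orders $D,E$ write $E\le_T D$ if there is $\phi:D\to E$ such that $\phi[X]$ is cofinal in $E$ for every cofinal $X\subseteq D$, and $E\equiv_T D$ if $E\le_T D$ and $D\le_T E$. A *sixth Tukey type* is a directed partial order of cardinality $\omega_1$ which is not Tukey equivalent to any of $1$, $\omega$, $\omega_1$, $\omega\times\omega_1$ (with the coordinatewise order) and $[\omega_1]^{<\omega}$ (ordered by inclusion). **Theorem.** (a) For every type $\tau$ and every $2$-capturing construction scheme $\mathcal F$ over $\omega_1$ of type $\tau$, $(\mathcal B_{\mathcal F},\le)$ is a sixth Tukey type. (b) If $CA_2$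 holds, then there is a sixth Tukey type. -/

import Mathlib

namespace SixthTukey

/-! ### Construction schemes -/

/-- A type `{(m_k, n_{k+1}, r_{k+1})}_{k ∈ ω}`. Here `n k` and `r k` are meaningful for `k ≥ 1`;
the values `n 0` and `r 0` play no role anywhere. -/
structure SchemeType where
  m : ℕ → ℕ
  n : ℕ → ℕ
  r : ℕ → ℕ
  m_zero : m 0 = 1
  two_le_n : ∀ k, 2 ≤ n (k + 1)
  r_infinitely_often : ∀ a : ℕ, {k : ℕ | 1 ≤ k ∧ r k = a}.Infinite
  r_lt_m : ∀ k, r (k + 1) < m k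
  m_succ : ∀ k, m (k + 1) = r (k + 1) + (m k - r (k + 1)) * n (k + 1)

section Scheme

variable {X : Type*} [LinearOrder X]

/-- `C ⊑ D`: `C` is an initial segment of `D`. -/
def IsInitialIn (C D : Finset X) : Prop :=
  C ⊆ D ∧ ∀ c ∈ C, ∀ d ∈ D, d ≤ c → d ∈ C

/-- `A < B` for finite sets: every element of `A` is below every element of `B`. -/
def AllLT (A B : Finset X) : Prop :=
  ∀ a ∈ A, ∀ b ∈ B, a < b

/-- `𝓕_k`: the members of `𝓕` whose rank in the well-founded order `(𝓕, ⊊)` is `k`. -/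
def level (𝓕 : Set (Finset X)) (k : ℕ) : Set (Finset X) :=
  {F | ∃ hF : F ∈ 𝓕, IsWellFounded.rank (fun G H : 𝓕 => G < H) ⟨F, hF⟩ = (k : Ordinal)}

/-- `D 0, …, D (n-1)` are members of `𝓕_k` with union `F`. -/
def IsDecomposition (𝓕 : Set (Finset X)) (k n : ℕ) (F : Finset X) (D : ℕ → Finset X) : Prop :=
  (∀ i < n, D i ∈ level 𝓕 k) ∧ F = (Finset.range n).biUnion D

/-- `D 0, …, D (n-1)` is a decomposition of `F` into members of `𝓕_k` which forms a
`Δ`-system with root `R`, where `|R| = r` and `R < D 0 \ R < ⋯ < D (n-1) \ R`. -/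
structure IsCanonicalDecomposition (𝓕 : Set (Finset X)) (k n r : ℕ) (F : Finset X)
    (D : ℕ → Finset X) (R : Finset X) : Prop where
  isDecomposition : IsDecomposition 𝓕 k n F D
  inter_eq_root : ∀ i < n, ∀ j < n, i ≠ j → D i ∩ D j = R
  card_root : R.card = r
  root_lt : ∀ i < n, AllLT R (D i \ R)
  lt_of_lt : ∀ i j, i < j → j < n → AllLT (D i \ R) (D j \ R)

/-- `𝓕` is a construction scheme over `X` of type `τ`, where `X` is a well-ordered set
(a set of ordinals). In the last clause the decomposition is unique as an unordered family. -/
structure IsConstructionScheme (τ : SchemeType) (𝓕 : Set (Finset X)) : Prop where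
  cofinal : ∀ A : Finset X, ∃ F ∈ 𝓕, A ⊆ F
  card_eq : ∀ k, ∀ F ∈ level 𝓕 k, F.card = τ.m k
  inter_initial : ∀ k, ∀ F ∈ level 𝓕 k, ∀ E ∈ level 𝓕 k,
    IsInitialIn (E ∩ F) E ∧ IsInitialIn (E ∩ F) F
  decomposition : ∀ k, ∀ F ∈ level 𝓕 (k + 1),
    ∃ D R, IsCanonicalDecomposition 𝓕 k (τ.n (k + 1)) (τ.r (k + 1)) F D R ∧
      ∀ D', IsDecomposition 𝓕 k (τ.n (k + 1)) F D' →
        (Finset.range (τ.n (k + 1))).image D' = (Finset.range (τ.n (k + 1))).image D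

/-- The ordinal metric: `ρ(α, β)` is the least `k` with `{α, β} ⊆ F` for some `F ∈ 𝓕_k`. -/
noncomputable def rho (𝓕 : Set (Finset X)) (α β : X) : ℕ :=
  sInf {k : ℕ | ∃ F ∈ level 𝓕 k, α ∈ F ∧ β ∈ F}

/-- `(α)_k = {ξ ≤ α : ρ(ξ, α) ≤ k}`. -/
def closure (𝓕 : Set (Finset X)) (k : ℕ) (α : X) : Set X :=
  {ξ | ξ ≤ α ∧ rho 𝓕 ξ α ≤ k}

/-- `f_α(l) = |(α)_l|`. -/
noncomputable def f (𝓕 : Set (Finset X)) (α : X) : ℕ → ℕ :=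
  fun l => (closure 𝓕 l α).ncard

/-- `𝓑_𝓕 = {f_α}_α`, a set of functions `ω → ω`. -/
def B (𝓕 : Set (Finset X)) : Set (ℕ → ℕ) :=
  Set.range (f 𝓕)

/-- `F` captures the finite family `𝒞`: for some `l`, `F ∈ 𝓕_{l+1}`, and with the canonical
decomposition `{F_i}` of `F` and its root `R`, the family `𝒞` has an enumeration `{c_i}` by
`|𝒞| ≤ n_{l+1}` indices such that `c_i ⊆ F_i`, `c_i ⊄ R`, and the increasing bijection
from `F_0` to `F_i` sends `c_0` to `c_i`. -/
def Captures (τ : SchemeType) (𝓕 : Set (Finset X)) (F : Finset X)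
    (𝒞 : Finset (Finset X)) : Prop :=
  ∃ l, F ∈ level 𝓕 (l + 1) ∧ 𝒞.card ≤ τ.n (l + 1) ∧
    ∃ D R, IsCanonicalDecomposition 𝓕 l (τ.n (l + 1)) (τ.r (l + 1)) F D R ∧
      ∃ c : ℕ → Finset X, 𝒞 = (Finset.range 𝒞.card).image c ∧
        ∀ i < 𝒞.card, c i ⊆ D i ∧ (c i \ R).Nonempty ∧
          ∃ φ : {x // x ∈ D 0} ≃o {x // x ∈ D i}, ∀ x, x.1 ∈ c 0 ↔ (φ x).1 ∈ c i

/-- `𝓕` is `n`-capturing. -/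
def IsCapturing (τ : SchemeType) (n : ℕ) (𝓕 : Set (Finset X)) : Prop :=
  ∀ S : Set (Finset X), ¬ S.Countable → ∀ k : ℕ,
    ∃ 𝒞 : Finset (Finset X), (𝒞 : Set (Finset X)) ⊆ S ∧ 𝒞.card = n ∧
      ∃ l, k < l ∧ ∃ F ∈ level 𝓕 l, Captures τ 𝓕 F 𝒞

end Scheme

/-- The ordinal `ω₁`, as the set of all countable ordinals. -/
abbrev Omega1 : Type 1 := Set.Iio (Ordinal.omega 1 : Ordinal.{0})

/-- The axiom `CA_n`: for every type `τ` with `n ≤ n_k` for all `k ≥ 1` there is an `n`-capturing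
construction scheme over `ω₁` of type `τ`. -/
def CapturingAxiom (n : ℕ) : Prop :=
  ∀ τ : SchemeType, (∀ k, n ≤ τ.n (k + 1)) →
    ∃ 𝓕 : Set (Finset Omega1), IsConstructionScheme τ 𝓕 ∧ IsCapturing τ n 𝓕

/-! ### The Tukey order -/

/-- `E ≤_T D`: some `φ : D → E` maps cofinal sets to cofinal sets. -/
def TukeyLE (E D : Type*) [PartialOrder E] [PartialOrder D] : Prop :=
  ∃ φ : D → E, ∀ A : Set D, IsCofinal A → IsCofinal (φ '' A)

/-- `E ≡_T D`. -/
def TukeyEquiv (E D : Type*) [PartialOrder E] [PartialOrder D] : Prop :=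
  TukeyLE E D ∧ TukeyLE D E

/-- `D` is a sixth Tukey type: a directed partial order of cardinality `ω₁` which is not Tukey
equivalent to any of `1`, `ω`, `ω₁`, `ω × ω₁` (coordinatewise order) and `[ω₁]^{<ω}`
(ordered by inclusion). -/
structure IsSixthTukeyType (D : Type*) [PartialOrder D] : Prop where
  directed : ∀ x y : D, ∃ z, x ≤ z ∧ y ≤ z
  card_eq : Cardinal.mk D = Cardinal.aleph 1
  not_equiv_one : ¬ TukeyEquiv D PUnit.{1}
  not_equiv_omega : ¬ TukeyEquiv D ℕ
  not_equiv_omega1 : ¬ TukeyEquiv D Omega1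
  not_equiv_prod : ¬ TukeyEquiv D (ℕ × Omega1)
  not_equiv_finset : ¬ TukeyEquiv D (Finset Omega1)

end SixthTukey

namespace SixthTukey

open Set

/-! ### Types -/

/-! The value `f 𝓕 α k` is the position of `α` in any member of level `k` containing it (`f_eq`). If
`α < β` lie in a common member of level `k`, their positions stay strictly ordered from level `k` on
(`f_lt`). Conversely, a position at one level determines the positions at all lower levels
(`f_eq_of_f_eq`).

By the first fact `α < β` forbids `f 𝓕 β ≤ f 𝓕 α`, so only countably many functions lie below a
given one. As `ℕ → ℕ` is second countable and upper bounds pass to closures, every uncountable part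
of `B 𝓕` has a countable unbounded subset. A reduction of `B 𝓕` to `ℕ × Omega1` would bound such a
subset, which excludes this type and the three simpler ones (`not_tukey_prod`).

A reduction of `Finset Omega1` to `B 𝓕` would give an uncountable family whose bounded subfamilies
are finite. Capturing singletons refutes this: among uncountably many points, two have comparable
functions agreeing on a prescribed initial segment (`exists_infinite_f_le`). -/

lemma SchemeType.m_lt_succ (τ : SchemeType) (k : ℕ) : τ.m k < τ.m (k + 1) := by
  have h1 := τ.r_lt_m k
  have h2 := τ.two_le_n k
  rw [τ.m_succ]
  obtain ⟨d, hd⟩ := Nat.exists_eq_add_of_lt h1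
  have h3 : τ.m k - τ.r (k + 1) = d + 1 := by omega
  rw [h3]
  nlinarith

lemma SchemeType.m_strictMono (τ : SchemeType) : StrictMono τ.m :=
  strictMono_nat_of_lt_succ τ.m_lt_succ

/-- The sizes of the members of the scheme of `binaryType`. -/
def binarySize : ℕ → ℕ
  | 0 => 1
  | k + 1 => (Nat.unpair k).1 + (binarySize k - (Nat.unpair k).1) * 2

lemma lt_binarySize (k : ℕ) : k < binarySize k := by
  induction k with
  | zero => simp [binarySize]
  | succ k ih =>
    have := Nat.unpair_left_le k
    rw [binarySize]
    omega

/-- A type all of whose decompositions are into two pieces. -/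
def binaryType : SchemeType where
  m := binarySize
  n _ := 2
  -- Unpairing takes every first coordinate infinitely often, and that coordinate never exceeds its
  -- argument, so it stays below the size.
  r k := (Nat.unpair (k - 1)).1
  m_zero := rfl
  two_le_n _ := le_rfl
  r_infinitely_often a := by
    refine infinite_of_injective_forall_mem (f := fun b : ℕ => Nat.pair a b + 1) ?_ ?_
    · intro b c h
      have h' : Nat.pair a b = Nat.pair a c := by simpa using h
      exact (Nat.pair_eq_pair.1 h').2
    · intro b
      simp
  r_lt_m k := by
    have h1 := Nat.unpair_left_le k
    have h2 := lt_binarySize k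
    simpa using h1.trans_lt h2
  m_succ _ := rfl

/-! ### Members of a construction scheme -/

section Scheme

lemma rank_le_card {X : Type*} {𝓕 : Set (Finset X)} (F : 𝓕) :
    IsWellFounded.rank (fun G H : 𝓕 => G < H) F ≤ (F.1.card : Ordinal) := by
  induction F using WellFoundedLT.induction with
  | ind F ih =>
    rw [IsWellFounded.rank_eq]
    refine Ordinal.iSup_le fun G => ?_
    rw [Order.succ_le_iff]
    refine (ih G.1 G.2).trans_lt ?_
    exact_mod_cast Finset.card_lt_card G.2

lemma exists_mem_level {X : Type*} {𝓕 : Set (Finset X)} {F : Finset X} (hF : F ∈ 𝓕) : ∃ k, F ∈ level 𝓕 k := by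
  obtain ⟨k, hk⟩ := Ordinal.lt_omega0.1
    ((rank_le_card ⟨F, hF⟩).trans_lt (Ordinal.natCast_lt_omega0 F.card))
  exact ⟨k, hF, hk⟩

variable {X : Type*} [LinearOrder X] {τ : SchemeType} {𝓕 : Set (Finset X)}

lemma IsConstructionScheme.exists_subset_of_mem (h : IsConstructionScheme τ 𝓕) {k l : ℕ}
    (hkl : k ≤ l) {F : Finset X} (hF : F ∈ level 𝓕 l) {α : X} (hα : α ∈ F) :
    ∃ E ∈ level 𝓕 k, E ⊆ F ∧ α ∈ E := by
  induction l, hkl using Nat.le_induction generalizing F with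
  | base => exact ⟨F, hF, subset_rfl, hα⟩
  | succ l _ ih =>
    obtain ⟨D, R, hD, -⟩ := h.decomposition l F hF
    obtain ⟨hDl, rfl⟩ := hD.isDecomposition
    obtain ⟨i, hi, hαi⟩ := Finset.mem_biUnion.1 hα
    obtain ⟨E, hE, hEF, hαE⟩ := ih (hDl i (Finset.mem_range.1 hi)) hαi
    exact ⟨E, hE, hEF.trans (Finset.subset_biUnion_of_mem D hi), hαE⟩

lemma IsConstructionScheme.exists_mem_level_superset [Infinite X]
    (h : IsConstructionScheme τ 𝓕) (k : ℕ) (A : Finset X) :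
    ∃ l, k ≤ l ∧ ∃ F ∈ level 𝓕 l, A ⊆ F := by
  -- Padding `A` with `τ.m k` points forces the level up to at least `k`.
  obtain ⟨C, hC⟩ := Infinite.exists_subset_card_eq X (τ.m k)
  obtain ⟨F, hF, hAF⟩ := h.cofinal (A ∪ C)
  obtain ⟨l, hl⟩ := exists_mem_level hF
  refine ⟨l, ?_, F, hl, Finset.subset_union_left.trans hAF⟩
  rw [← τ.m_strictMono.le_iff_le, ← h.card_eq l F hl, ← hC]
  exact Finset.card_le_card (Finset.subset_union_right.trans hAF)

lemma IsConstructionScheme.exists_mem_level_mem [Infinite X]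
    (h : IsConstructionScheme τ 𝓕) (k : ℕ) (α : X) : ∃ F ∈ level 𝓕 k, α ∈ F := by
  obtain ⟨l, hkl, F, hF, hαF⟩ := h.exists_mem_level_superset k {α}
  obtain ⟨E, hE, -, hαE⟩ := h.exists_subset_of_mem hkl hF (Finset.singleton_subset_iff.1 hαF)
  exact ⟨E, hE, hαE⟩

/-- A member of a lower level meets a member of a higher one in an initial segment of the
former. -/
lemma IsConstructionScheme.mem_of_le (h : IsConstructionScheme τ 𝓕) {k l : ℕ} (hkl : k ≤ l)
    {E F : Finset X} (hE : E ∈ level 𝓕 k) (hF : F ∈ level 𝓕 l) {α ξ : X}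
    (hαE : α ∈ E) (hαF : α ∈ F) (hξE : ξ ∈ E) (hξ : ξ ≤ α) : ξ ∈ F := by
  obtain ⟨G, hG, hGF, hαG⟩ := h.exists_subset_of_mem hkl hF hαF
  have := (h.inter_initial k G hG E hE).1.2 α (Finset.mem_inter.2 ⟨hαE, hαG⟩) ξ hξE hξ
  exact hGF (Finset.mem_inter.1 this).2

/-- A member witnessing `ρ(ξ, α) ≤ k` meets `F` in an initial segment of itself, so `F` catches `ξ`;
the choice of `F` is immaterial. -/
lemma IsConstructionScheme.closure_eq (h : IsConstructionScheme τ 𝓕) {k : ℕ}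
    {F : Finset X} (hF : F ∈ level 𝓕 k) {α : X} (hα : α ∈ F) :
    closure 𝓕 k α = (F.filter (· ≤ α) : Finset X) := by
  ext ξ
  simp only [closure, mem_ofPred_eq, Finset.coe_filter]
  refine ⟨fun ⟨hξ, hρ⟩ => ⟨?_, hξ⟩, fun ⟨hξF, hξ⟩ => ⟨hξ, Nat.sInf_le ⟨F, hF, hξF, hα⟩⟩⟩
  have hne : {k : ℕ | ∃ F ∈ level 𝓕 k, ξ ∈ F ∧ α ∈ F}.Nonempty := by
    obtain ⟨G, hG, hsub⟩ := h.cofinal {ξ, α}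
    obtain ⟨l, hl⟩ := exists_mem_level hG
    exact ⟨l, G, hl, hsub (by simp), hsub (by simp)⟩
  obtain ⟨E, hE, hξE, hαE⟩ := Nat.sInf_mem hne
  exact h.mem_of_le hρ hE hF hαE hα hξE hξ

lemma IsConstructionScheme.f_eq (h : IsConstructionScheme τ 𝓕) {k : ℕ}
    {F : Finset X} (hF : F ∈ level 𝓕 k) {α : X} (hα : α ∈ F) :
    f 𝓕 α k = (F.filter (· ≤ α)).card := by
  rw [f, h.closure_eq hF hα, ncard_coe_finset]

lemma IsConstructionScheme.f_le [Infinite X] (h : IsConstructionScheme τ 𝓕) (α : X) (k : ℕ) :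
    f 𝓕 α k ≤ τ.m k := by
  obtain ⟨F, hF, hα⟩ := h.exists_mem_level_mem k α
  rw [h.f_eq hF hα, ← h.card_eq k F hF]
  exact Finset.card_filter_le _ _

lemma IsConstructionScheme.f_lt_of_mem (h : IsConstructionScheme τ 𝓕) {k : ℕ}
    {F : Finset X} (hF : F ∈ level 𝓕 k) {α β : X} (hα : α ∈ F) (hβ : β ∈ F) (hαβ : α < β) :
    f 𝓕 α k < f 𝓕 β k := by
  rw [h.f_eq hF hα, h.f_eq hF hβ]
  refine Finset.card_lt_card (Finset.ssubset_iff_of_subset ?_ |>.2 ⟨β, ?_, ?_⟩)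
  · exact Finset.monotone_filter_right F fun x _ hx => le_trans hx hαβ.le
  · simp [hβ]
  · simp [hαβ]

lemma IsConstructionScheme.f_lt [Infinite X] (h : IsConstructionScheme τ 𝓕) {k l : ℕ}
    (hkl : k ≤ l) {F : Finset X} (hF : F ∈ level 𝓕 k) {α β : X} (hα : α ∈ F) (hβ : β ∈ F)
    (hαβ : α < β) : f 𝓕 α l < f 𝓕 β l := by
  obtain ⟨G, hG, hβG⟩ := h.exists_mem_level_mem l β
  exact h.f_lt_of_mem hG (h.mem_of_le hkl hF hG hβ hβG hα hαβ.le) hβG hαβ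

lemma IsConstructionScheme.not_f_le [Infinite X] (h : IsConstructionScheme τ 𝓕) {α β : X}
    (hαβ : α < β) : ¬ f 𝓕 β ≤ f 𝓕 α := by
  obtain ⟨k, -, F, hF, hsub⟩ := h.exists_mem_level_superset 0 {α, β}
  exact fun hle => (hle k).not_gt (h.f_lt_of_mem hF (hsub (by simp)) (hsub (by simp)) hαβ)

lemma IsConstructionScheme.f_injective [Infinite X] (h : IsConstructionScheme τ 𝓕) :
    Function.Injective (f 𝓕) := by
  intro α β hαβ
  by_contra hne
  rcases lt_or_gt_of_ne hne with hlt | hlt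
  · exact h.not_f_le hlt hαβ.ge
  · exact h.not_f_le hlt hαβ.le

/-- The last element of a member of the scheme is last in the members of lower levels. -/
lemma IsConstructionScheme.f_max (h : IsConstructionScheme τ 𝓕) {k l : ℕ} (hkl : k ≤ l)
    {F : Finset X} (hF : F ∈ level 𝓕 l) {γ : X} (hγ : γ ∈ F) (hmax : ∀ x ∈ F, x ≤ γ) :
    f 𝓕 γ k = τ.m k := by
  obtain ⟨E, hE, hEF, hγE⟩ := h.exists_subset_of_mem hkl hF hγ
  rw [h.f_eq hE hγE, Finset.filter_true_of_mem fun x hx => hmax x (hEF hx), h.card_eq k E hE]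

lemma IsConstructionScheme.exists_f_ge [Infinite X] (h : IsConstructionScheme τ 𝓕) (α β : X) :
    ∃ γ, f 𝓕 α ≤ f 𝓕 γ ∧ f 𝓕 β ≤ f 𝓕 γ := by
  obtain ⟨k, -, F, hF, hsub⟩ := h.exists_mem_level_superset 0 {α, β}
  have hα : α ∈ F := hsub (by simp)
  have hβ : β ∈ F := hsub (by simp)
  have hne : F.Nonempty := ⟨α, hα⟩
  -- Up to level `k` the maximum of `F` attains the universal bound `τ.m l`; from `k` on, the order
  -- inside `F` persists.
  have key : ∀ δ ∈ F, f 𝓕 δ ≤ f 𝓕 (F.max' hne) := by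
    intro δ hδ l
    rcases le_total l k with hl | hl
    · rw [h.f_max hl hF (F.max'_mem _) (F.le_max')]
      exact h.f_le δ l
    · rcases (F.le_max' δ hδ).eq_or_lt with heq | hlt
      · rw [← heq]
      · exact (h.f_lt hl hF hδ (F.max'_mem _) hlt).le
  exact ⟨_, key α hα, key β hβ⟩

/-! ### Positions in the pieces of a decomposition -/

lemma IsCanonicalDecomposition.root_subset {k n r : ℕ} {F R : Finset X} {D : ℕ → Finset X}
    (hD : IsCanonicalDecomposition 𝓕 k n r F D R) (hn : 2 ≤ n) {i : ℕ} (hi : i < n) :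
    R ⊆ D i := by
  obtain ⟨j, hj, hij⟩ : ∃ j < n, i ≠ j := by
    rcases Nat.eq_zero_or_pos i with rfl | hpos
    · exact ⟨1, by omega, by omega⟩
    · exact ⟨0, by omega, by omega⟩
  rw [← hD.inter_eq_root i hi j hj hij]
  exact Finset.inter_subset_left

lemma IsCanonicalDecomposition.filter_le_of_mem_root {k n r : ℕ} {F R : Finset X}
    {D : ℕ → Finset X} (hD : IsCanonicalDecomposition 𝓕 k n r F D R) (hn : 2 ≤ n)
    {i : ℕ} (hi : i < n) {α : X} (hα : α ∈ R) :
    F.filter (· ≤ α) = R.filter (· ≤ α) ∧ (D i).filter (· ≤ α) = R.filter (· ≤ α) := by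
  have key : ∀ j < n, ∀ x ∈ D j, x ≤ α → x ∈ R := by
    intro j hj x hx hxα
    by_contra hxR
    exact (hD.root_lt j hj α hα x (Finset.mem_sdiff.2 ⟨hx, hxR⟩)).not_ge hxα
  have hR := hD.root_subset hn hi
  have hF := hD.isDecomposition.2
  constructor
  · ext x
    simp only [hF, Finset.mem_filter, Finset.mem_biUnion, Finset.mem_range]
    exact ⟨fun ⟨⟨j, hj, hx⟩, hxα⟩ => ⟨key j hj x hx hxα, hxα⟩,
      fun ⟨hx, hxα⟩ => ⟨⟨i, hi, hR hx⟩, hxα⟩⟩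
  · ext x
    simp only [Finset.mem_filter]
    exact ⟨fun ⟨hx, hxα⟩ => ⟨key i hi x hx hxα, hxα⟩, fun ⟨hx, hxα⟩ => ⟨hR hx, hxα⟩⟩

/-- Besides the points of `D i`, exactly the `i` earlier pieces lie below `α`, each adding `m - r`
points outside the root. -/
lemma IsCanonicalDecomposition.card_filter_le {k n r m : ℕ} {F R : Finset X}
    {D : ℕ → Finset X} (hD : IsCanonicalDecomposition 𝓕 k n r F D R) (hn : 2 ≤ n)
    (hm : ∀ i < n, (D i).card = m) {i : ℕ} (hi : i < n) {α : X} (hα : α ∈ D i) (hαR : α ∉ R) :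
    (F.filter (· ≤ α)).card = ((D i).filter (· ≤ α)).card + i * (m - r) := by
  have hdis : ∀ j < i, ∀ x ∈ D j \ R, x < α := fun j hj x hx =>
    hD.lt_of_lt j i hj hi x hx α (Finset.mem_sdiff.2 ⟨hα, hαR⟩)
  have hFeq : F.filter (· ≤ α) =
      (D i).filter (· ≤ α) ∪ (Finset.range i).biUnion fun j => D j \ R := by
    ext x
    simp only [hD.isDecomposition.2, Finset.mem_filter, Finset.mem_biUnion, Finset.mem_range,
      Finset.mem_union]
    constructor
    · rintro ⟨⟨j, hj, hx⟩, hxα⟩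
      by_cases hxR : x ∈ R
      · exact .inl ⟨hD.root_subset hn hi hxR, hxα⟩
      rcases lt_trichotomy j i with hji | rfl | hij
      · exact .inr ⟨j, hji, Finset.mem_sdiff.2 ⟨hx, hxR⟩⟩
      · exact .inl ⟨hx, hxα⟩
      · exact absurd (hD.lt_of_lt i j hij hj α (Finset.mem_sdiff.2 ⟨hα, hαR⟩) x
          (Finset.mem_sdiff.2 ⟨hx, hxR⟩)) hxα.not_gt
    · rintro (⟨hx, hxα⟩ | ⟨j, hj, hx⟩)
      · exact ⟨⟨i, hi, hx⟩, hxα⟩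
      · exact ⟨⟨j, hj.trans hi, (Finset.mem_sdiff.1 hx).1⟩, (hdis j hj x hx).le⟩
  have hpiece : ∀ a < n, ∀ b < n, a ≠ b → ∀ x ∈ D a, x ∈ D b → x ∈ R := by
    intro a ha b hb hab x hxa hxb
    rw [← hD.inter_eq_root a ha b hb hab]
    exact Finset.mem_inter.2 ⟨hxa, hxb⟩
  rw [hFeq, Finset.card_union_of_disjoint, Finset.card_biUnion]
  · congr 1
    rw [Finset.sum_const_nat (m := m - r), Finset.card_range]
    intro j hj
    have hjn := (Finset.mem_range.1 hj).trans hi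
    rw [Finset.card_sdiff_of_subset (hD.root_subset hn hjn), hm j hjn, hD.card_root]
  · intro a ha b hb hab
    refine Finset.disjoint_left.2 fun x hxa hxb => ?_
    rw [Finset.mem_sdiff] at hxa hxb
    exact hxa.2 (hpiece a ((Finset.mem_range.1 ha).trans hi) b ((Finset.mem_range.1 hb).trans hi)
      hab x hxa.1 hxb.1)
  · refine Finset.disjoint_left.2 fun x hx hx' => ?_
    obtain ⟨j, hj, hxj⟩ := Finset.mem_biUnion.1 hx'
    have hji := Finset.mem_range.1 hj
    rw [Finset.mem_sdiff] at hxj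
    exact hxj.2 (hpiece j (hji.trans hi) i hi hji.ne x hxj.1 (Finset.mem_filter.1 hx).1)

lemma IsConstructionScheme.f_succ_cases [Infinite X] (h : IsConstructionScheme τ 𝓕) (k : ℕ)
    (α : X) : (f 𝓕 α (k + 1) = f 𝓕 α k ∧ f 𝓕 α k ≤ τ.r (k + 1)) ∨
      ∃ i q, q < τ.m k - τ.r (k + 1) ∧ f 𝓕 α k = τ.r (k + 1) + 1 + q ∧
        f 𝓕 α (k + 1) = f 𝓕 α k + i * (τ.m k - τ.r (k + 1)) := by
  obtain ⟨F, hF, hαF⟩ := h.exists_mem_level_mem (k + 1) α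
  obtain ⟨D, R, hD, -⟩ := h.decomposition k F hF
  have hn := τ.two_le_n k
  have hαF' := hαF
  rw [hD.isDecomposition.2] at hαF'
  obtain ⟨i, hi, hαi⟩ := Finset.mem_biUnion.1 hαF'
  rw [Finset.mem_range] at hi
  have hDl := hD.isDecomposition.1
  rw [h.f_eq hF hαF, h.f_eq (hDl i hi) hαi]
  by_cases hαR : α ∈ R
  · left
    obtain ⟨h1, h2⟩ := hD.filter_le_of_mem_root hn hi hαR
    rw [h1, h2]
    exact ⟨rfl, (Finset.card_filter_le _ _).trans hD.card_root.le⟩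
  · right
    have hle : ((D i).filter (· ≤ α)).card ≤ τ.m k :=
      (Finset.card_filter_le _ _).trans (h.card_eq k _ (hDl i hi)).le
    have hge : τ.r (k + 1) + 1 ≤ ((D i).filter (· ≤ α)).card := by
      rw [← hD.card_root, ← Finset.card_insert_of_notMem hαR]
      refine Finset.card_le_card fun x hx => ?_
      rw [Finset.mem_filter]
      rcases Finset.mem_insert.1 hx with rfl | hx
      · exact ⟨hαi, le_rfl⟩
      · exact ⟨hD.root_subset hn hi hx,
          (hD.root_lt i hi x hx α (Finset.mem_sdiff.2 ⟨hαi, hαR⟩)).le⟩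
    refine ⟨i, ((D i).filter (· ≤ α)).card - (τ.r (k + 1) + 1), by omega, by omega, ?_⟩
    exact hD.card_filter_le hn (fun j hj => h.card_eq k _ (hDl j hj)) hi hαi hαR

/-- The position of a point in the members of level `k + 1` determines its position in the members
of level `k`. -/
lemma IsConstructionScheme.f_eq_of_f_succ_eq [Infinite X] (h : IsConstructionScheme τ 𝓕) {k : ℕ}
    {α β : X} (hαβ : f 𝓕 α (k + 1) = f 𝓕 β (k + 1)) : f 𝓕 α k = f 𝓕 β k := by
  rcases h.f_succ_cases k α with ⟨h1, h2⟩ | ⟨i, q, hq, h1, h2⟩ <;>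
  rcases h.f_succ_cases k β with ⟨h3, h4⟩ | ⟨j, p, hp, h3, h4⟩
  · omega
  · omega
  · omega
  -- Both points are off the root; reducing modulo `d` forgets the index of the piece and recovers
  -- the position in it.
  · set d := τ.m k - τ.r (k + 1)
    have heq : q + i * d = p + j * d := by omega
    have hmod := congrArg (· % d) heq
    simp only [Nat.add_mul_mod_self_right, Nat.mod_eq_of_lt hq, Nat.mod_eq_of_lt hp] at hmod
    omega

lemma IsConstructionScheme.f_eq_of_f_eq [Infinite X] (h : IsConstructionScheme τ 𝓕) {k l : ℕ}
    (hkl : k ≤ l) {α β : X} (hαβ : f 𝓕 α l = f 𝓕 β l) : f 𝓕 α k = f 𝓕 β k := by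
  induction l, hkl using Nat.le_induction with
  | base => exact hαβ
  | succ l _ ih => exact ih (h.f_eq_of_f_succ_eq hαβ)

lemma card_filter_le_orderIso {E F : Finset X} (φ : {x // x ∈ E} ≃o {x // x ∈ F})
    (x : {x // x ∈ E}) :
    (E.filter (· ≤ x.1)).card = (F.filter (· ≤ (φ x).1)).card := by
  have aux : ∀ (G : Finset X) (y : {x // x ∈ G}),
      (G.filter (· ≤ y.1)).card = (Finset.univ.filter (· ≤ y)).card := by
    intro G y
    refine (Finset.card_bij (fun z _ => z.1) ?_ ?_ ?_).symm
    · intro z hz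
      simpa using (Finset.mem_filter.1 hz).2
    · intro a _ b _ hab
      exact Subtype.ext hab
    · intro b hb
      rw [Finset.mem_filter] at hb
      exact ⟨⟨b, hb.1⟩, Finset.mem_filter.2 ⟨Finset.mem_univ _, hb.2⟩, rfl⟩
  rw [aux, aux]
  refine Finset.card_equiv φ.toEquiv fun y => ?_
  simp

/-- In a `2`-capturing scheme every uncountable set of points has two points whose functions are
comparable and agree as far as prescribed. -/
lemma IsConstructionScheme.exists_f_le_of_isCapturing [Infinite X]
    (h : IsConstructionScheme τ 𝓕) (hc : IsCapturing τ 2 𝓕) {T : Set X} (hT : ¬ T.Countable)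
    (k : ℕ) : ∃ α ∈ T, ∃ β ∈ T, α ≠ β ∧ f 𝓕 α ≤ f 𝓕 β ∧ ∀ j ≤ k, f 𝓕 α j = f 𝓕 β j := by
  have hS : ¬ ((fun α : X => ({α} : Finset X)) '' T).Countable := fun hcount =>
    hT (countable_of_injective_of_countable_image Finset.singleton_injective.injOn hcount)
  obtain ⟨𝒞, h𝒞, hcard, l, hkl, F, hF, l', hF', -, D, R, hD, c, hceq, hcap⟩ := hc _ hS k
  -- Capturing names its own level; the size of `F` identifies it with `l`.
  have hl : l = l' + 1 := by
    refine τ.m_strictMono.injective ?_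
    rw [← h.card_eq l F hF, ← h.card_eq _ F hF']
  rw [hcard] at hceq hcap
  have hn := τ.two_le_n l'
  have hsing : ∀ i < 2, ∃ α ∈ T, c i = {α} := by
    intro i hi
    have hmem : c i ∈ 𝒞 := by
      rw [hceq]
      exact Finset.mem_image_of_mem c (Finset.mem_range.2 hi)
    obtain ⟨α, hα, hαc⟩ := h𝒞 hmem
    exact ⟨α, hα, hαc.symm⟩
  obtain ⟨α, hαT, hα⟩ := hsing 0 (by norm_num)
  obtain ⟨β, hβT, hβ⟩ := hsing 1 (by norm_num)
  obtain ⟨hα1, hα2, -⟩ := hcap 0 (by norm_num)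
  obtain ⟨hβ1, hβ2, φ, hφ⟩ := hcap 1 (by norm_num)
  have hαD : α ∈ D 0 := hα1 (by simp [hα])
  have hβD : β ∈ D 1 := hβ1 (by simp [hβ])
  have hαR : α ∈ D 0 \ R := by
    obtain ⟨x, hx⟩ := hα2
    rw [hα, Finset.mem_sdiff, Finset.mem_singleton] at hx
    exact Finset.mem_sdiff.2 ⟨hαD, hx.1 ▸ hx.2⟩
  have hβR : β ∈ D 1 \ R := by
    obtain ⟨x, hx⟩ := hβ2
    rw [hβ, Finset.mem_sdiff, Finset.mem_singleton] at hx
    exact Finset.mem_sdiff.2 ⟨hβD, hx.1 ▸ hx.2⟩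
  have hlt : α < β := hD.lt_of_lt 0 1 (by norm_num) (by omega) α hαR β hβR
  have hφα : (φ ⟨α, hαD⟩).1 = β := by
    have := (hφ ⟨α, hαD⟩).1 (by simp [hα])
    rwa [hβ, Finset.mem_singleton] at this
  have hDl := hD.isDecomposition.1
  have hfl : f 𝓕 α l' = f 𝓕 β l' := by
    rw [h.f_eq (hDl 0 (by omega)) hαD, h.f_eq (hDl 1 (by omega)) hβD,
      card_filter_le_orderIso φ ⟨α, hαD⟩, hφα]
  have hsub : ∀ i < τ.n (l' + 1), D i ⊆ F := by
    intro i hi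
    rw [hD.isDecomposition.2]
    exact Finset.subset_biUnion_of_mem D (Finset.mem_range.2 hi)
  refine ⟨α, hαT, β, hβT, hlt.ne, fun j => ?_, fun j hj => h.f_eq_of_f_eq (by omega) hfl⟩
  -- Above `l'` the common member `F` orders the functions; up to `l'` they coincide.
  rcases Nat.lt_or_ge l' j with hj | hj
  · exact (h.f_lt hj hF' (hsub 0 (by omega) hαD) (hsub 1 (by omega) hβD) hlt).le
  · exact (h.f_eq_of_f_eq hj hfl).le

/-- In a `2`-capturing scheme there is no uncountable family of functions all of whose bounded
subfamilies are finite. -/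
lemma IsConstructionScheme.exists_infinite_f_le [Infinite X] {I : Type*} [Uncountable I]
    (h : IsConstructionScheme τ 𝓕) (hc : IsCapturing τ 2 𝓕) (a : I → X) :
    ∃ γ, {i | f 𝓕 (a i) ≤ f 𝓕 γ}.Infinite := by
  by_contra! hfin
  -- Only finitely many indices lie below `f 𝓕 β`, so a single `k` separates them all from `β`.
  have hsep : ∀ β : X, ∃ k, ∀ i, f 𝓕 (a i) ≤ f 𝓕 β → (∀ j ≤ k, f 𝓕 (a i) j = f 𝓕 β j) →
      a i = β := by
    intro β
    have : ∀ i, ∃ k, f 𝓕 (a i) k = f 𝓕 β k → a i = β := by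
      intro i
      by_cases hi : a i = β
      · exact ⟨0, fun _ => hi⟩
      · obtain ⟨k, hk⟩ := Function.ne_iff.1 (h.f_injective.ne hi)
        exact ⟨k, fun h' => absurd h' hk⟩
    choose k hk using this
    obtain ⟨K, hK⟩ := ((hfin β).image k).bddAbove
    exact ⟨K, fun i hi hij => hk i (hij _ (hK (mem_image_of_mem k hi)))⟩
  choose K hK using hsep
  obtain ⟨N, hN⟩ : ∃ N, ¬ {i | K (a i) = N}.Countable := by
    by_contra! hcount
    refine not_countable_univ (α := I) ((countable_iUnion hcount).mono fun i _ => ?_)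
    exact mem_iUnion.2 ⟨K (a i), rfl⟩
  -- Each fibre of `a` is a bounded subfamily, hence finite.
  have hT : ¬ (a '' {i | K (a i) = N}).Countable := by
    intro hcount
    refine hN ((hcount.biUnion fun x _ => (hfin x).countable).mono fun i hi => ?_)
    exact mem_biUnion (mem_image_of_mem a hi) (le_refl (f 𝓕 (a i)))
  obtain ⟨_, ⟨i, hi, rfl⟩, _, ⟨j, hj, rfl⟩, hne, hle, heq⟩ :=
    h.exists_f_le_of_isCapturing hc hT N
  exact hne (hK (a j) i hle fun p hp => heq p (hp.trans_eq hj))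

end Scheme

/-! ### Tukey maps -/

/-- If no `d` worked for some `e`, the points whose `φ`-value is not above `e` would be cofinal,
with an image that is not cofinal. -/
lemma TukeyLE.exists_forall_le {E D : Type*} [PartialOrder E] [PartialOrder D]
    (h : TukeyLE E D) : ∃ (φ : D → E) (g : E → D), ∀ e d, g e ≤ d → e ≤ φ d := by
  obtain ⟨φ, hφ⟩ := h
  have : ∀ e, ∃ d, ∀ d', d ≤ d' → e ≤ φ d' := by
    intro e
    by_contra! hcon
    have hcof : IsCofinal {d | ¬ e ≤ φ d} := fun d => by
      obtain ⟨d', hd, hd'⟩ := hcon d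
      exact ⟨d', hd', hd⟩
    obtain ⟨_, ⟨d, hd, rfl⟩, hed⟩ := hφ _ hcof e
    exact hd hed
  choose g hg using this
  exact ⟨φ, g, hg⟩

lemma mk_omega1 : Cardinal.mk Omega1 = Cardinal.aleph 1 := by
  rw [Cardinal.mk_Iio_ordinal, ← Cardinal.ord_aleph, Cardinal.card_ord]
  simp

instance : Uncountable Omega1 := by
  rw [← Cardinal.aleph0_lt_mk_iff, mk_omega1]
  simp

lemma exists_forall_le_omega1 {A : Set Omega1} (hA : A.Countable) :
    ∃ δ : Omega1, ∀ a ∈ A, a ≤ δ := by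
  have := hA.to_subtype
  refine ⟨⟨⨆ a : A, a.1.1, Ordinal.iSup_lt_omega_one fun a => a.1.2⟩, fun a ha => ?_⟩
  exact Ordinal.le_iSup (fun a : A => a.1.1) ⟨a, ha⟩

/-! ### The Tukey type of `B 𝓕` over `ω₁` -/

section Omega1

variable {τ : SchemeType} {𝓕 : Set (Finset Omega1)}

lemma IsConstructionScheme.uncountable_B (h : IsConstructionScheme τ 𝓕) : Uncountable (B 𝓕) :=
  (Equiv.ofInjective _ h.f_injective).uncountable_iff.1 inferInstance

/-- A countable set of functions which is dense in an uncountable set is unbounded. -/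
lemma IsConstructionScheme.exists_countable_unbounded (h : IsConstructionScheme τ 𝓕)
    {S : Set (B 𝓕)} (hS : ¬ S.Countable) :
    ∃ A ⊆ S, A.Countable ∧ ∀ b : B 𝓕, ∃ a ∈ A, ¬ a ≤ b := by
  obtain ⟨A, hAS, hA, hSA⟩ :=
    (TopologicalSpace.IsSeparable.of_separableSpace S).exists_countable_dense_subset
  refine ⟨A, hAS, hA, ?_⟩
  rintro ⟨_, γ, rfl⟩
  by_contra! hle
  have hclosed : IsClosed {b : B 𝓕 | b.1 ≤ f 𝓕 γ} :=
    isClosed_le continuous_subtype_val continuous_const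
  have hSle : S ⊆ {b : B 𝓕 | b.1 ≤ f 𝓕 γ} := hSA.trans (closure_minimal hle hclosed)
  have hcount : (Iic γ).Countable := by
    have hlt : γ.1.card < Cardinal.aleph 1 := by
      rw [← Cardinal.lt_ord, Cardinal.ord_aleph]
      exact γ.2
    have hIio : (Iio γ.1).Countable := by
      rw [← Cardinal.le_aleph0_iff_set_countable, Cardinal.mk_Iio_ordinal, Cardinal.lift_le_aleph0,
        ← Order.lt_succ_iff, Cardinal.succ_aleph0]
      exact hlt
    refine ((hIio.insert γ.1).preimage Subtype.val_injective).mono fun α hα => ?_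
    exact (mem_Iic.1 hα).eq_or_lt.imp (congrArg Subtype.val) id
  refine hS (((hcount.image fun α => (⟨f 𝓕 α, α, rfl⟩ : B 𝓕))).mono ?_)
  rintro ⟨_, α, rfl⟩ hα
  exact ⟨α, not_lt.1 fun hlt => h.not_f_le hlt (hSle hα), rfl⟩

lemma IsConstructionScheme.not_tukey_prod (h : IsConstructionScheme τ 𝓕)
    (φ : ℕ × Omega1 → B 𝓕) (g : B 𝓕 → ℕ × Omega1) : ¬ ∀ b p, g b ≤ p → b ≤ φ p := by
  intro hg
  have := h.uncountable_B
  obtain ⟨N, hN⟩ : ∃ N, ¬ {b | (g b).1 = N}.Countable := by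
    by_contra! hcount
    refine not_countable_univ (α := B 𝓕) ((countable_iUnion hcount).mono fun b _ => ?_)
    exact mem_iUnion.2 ⟨(g b).1, rfl⟩
  obtain ⟨A, hAS, hA, hunb⟩ := h.exists_countable_unbounded hN
  -- With first coordinate fixed at `N`, the countable image of `A` is bounded by `(N, δ)`, so `φ
  -- (N, δ)` would bound `A`.
  obtain ⟨δ, hδ⟩ := exists_forall_le_omega1 (hA.image fun b => (g b).2)
  obtain ⟨a, ha, hnot⟩ := hunb (φ (N, δ))
  exact hnot (hg a _ ⟨(hAS ha).le, hδ _ (mem_image_of_mem _ ha)⟩)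

theorem IsConstructionScheme.isSixthTukeyType (h : IsConstructionScheme τ 𝓕)
    (hc : IsCapturing τ 2 𝓕) : IsSixthTukeyType (B 𝓕) where
  directed := by
    rintro ⟨_, α, rfl⟩ ⟨_, β, rfl⟩
    obtain ⟨γ, h1, h2⟩ := h.exists_f_ge α β
    exact ⟨⟨_, γ, rfl⟩, h1, h2⟩
  card_eq := by
    have := Cardinal.mk_range_eq_of_injective h.f_injective
    rw [mk_omega1] at this
    simpa [B] using this
  not_equiv_one := fun ⟨hle, _⟩ => by
    obtain ⟨φ, g, hg⟩ := hle.exists_forall_le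
    exact h.not_tukey_prod (fun _ => φ ⟨⟩) (fun _ => (0, Classical.arbitrary Omega1))
      fun b _ _ => hg b _ le_rfl
  not_equiv_omega := fun ⟨hle, _⟩ => by
    obtain ⟨φ, g, hg⟩ := hle.exists_forall_le
    exact h.not_tukey_prod (fun p => φ p.1) (fun b => (g b, Classical.arbitrary Omega1))
      fun b _ hp => hg b _ hp.1
  not_equiv_omega1 := fun ⟨hle, _⟩ => by
    obtain ⟨φ, g, hg⟩ := hle.exists_forall_le
    exact h.not_tukey_prod (fun p => φ p.2) (fun b => (0, g b)) fun b _ hp => hg b _ hp.2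
  not_equiv_prod := fun ⟨hle, _⟩ => by
    obtain ⟨φ, g, hg⟩ := hle.exists_forall_le
    exact h.not_tukey_prod φ g hg
  not_equiv_finset := fun ⟨_, hle⟩ => by
    obtain ⟨φ, g, hg⟩ := hle.exists_forall_le
    -- If `g {i}` lies below `f 𝓕 γ`, then `i` belongs to the finite set that `φ` assigns to it.
    choose a ha using fun i : Omega1 => (g {i}).2
    obtain ⟨γ, hγ⟩ := h.exists_infinite_f_le hc a
    refine hγ ((φ ⟨f 𝓕 γ, γ, rfl⟩).finite_toSet.subset fun i hi => ?_)
    refine Finset.singleton_subset_iff.1 (hg {i} _ ?_)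
    exact (ha i).ge.trans hi

end Omega1

end SixthTukey

theorem mainTheorem11 :
    (∀ (τ : SixthTukey.SchemeType) (𝓕 : Set (Finset SixthTukey.Omega1)),
      SixthTukey.IsConstructionScheme τ 𝓕 → SixthTukey.IsCapturing τ 2 𝓕 →
        SixthTukey.IsSixthTukeyType (SixthTukey.B 𝓕)) ∧
    (SixthTukey.CapturingAxiom 2 →
      ∃ (D : Type) (_ : PartialOrder D), SixthTukey.IsSixthTukeyType D) := by
  refine ⟨fun τ 𝓕 h hc => h.isSixthTukeyType hc, fun hCA => ?_⟩
  obtain ⟨𝓕, h, hc⟩ := hCA SixthTukey.binaryType fun _ => le_rfl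
  exact ⟨_, _, h.isSixthTukeyType hc⟩
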